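/- Let $A\in\mathbb R^{n\times n}$, $B\in\mathbb R^{n\times r}$, $C\in\mathbb R^{r\times n}$ define the square system $\dot x=Ax+Bu$, $y=Cx$, and suppose that it is controllable, i.e. $\operatorname{rank}[B,AB,\dots,A^{n-1}B]=n$. Let $$P(s)=\begin{bmatrix} sI_n-A & -B\\ C & 0\end{bmatrix}$$ be its system matrix, and call the system degenerate if $\det P(s)\equiv 0$. For $k\ge 0$ consider the minors of $P(s)$ of order $n+k$ formed by the first $n$ rows and columns together with $k$ of the last $r$ rows and $k$ of the last $r$ columns; the system zeros are the complex roots, counted with multiplicity, of the greatest common divisor of these minors for the largest $k$ for which they are not all identically zero (for a nondegenerate system these are the roots of $\det P(s)$). Let the controllability index $\nu$ be the smallest positive integer with $\operatorname{rank}[B,\dots,A^{\nu-1}B]=\operatorname{rank}[B,\dots,A^{n-1}B]$ and let $l_{i}=\operatorname{rank}[B,\dots,A^{\nu-i}B]-\operatorname{rank}[B,\dots,A^{\nu-i-1}B]$, so that $l_\nu=\operatorname{rank}B$ and $l_{\nu-1}=\operatorname{rank}[B,AB]-\operatorname{rank}B$. Then: 1. If $\operatorname{rank}(CB)=r$, the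 system has exactly $n-r$ system zeros. 2. If $CB$ has rank deficiency $d=r-\operatorname{rank}(CB)$ and the system is nondegenerate, it has at most $n-r-d$ system zeros. 3. Suppose $CB=0$. 3.1. If $l_{\nu-1}=r$ and $\operatorname{rank}(CAB)=r$, the system has exactly $n-2r$ system zeros. 3.2. If $l_{\nu-1}=r$, $\operatorname{rank}(CAB)<r$ with rank deficiency $\bar d=r-\operatorname{rank}(CAB)$, and the system is nondegenerate, it has at most $n-2r-\bar d$ system zeros. 3.3. If $l_{\nu-1}<r$, $\operatorname{rank}(CAB)=l_{\nu-1}$, and the system is nondegenerate, it has at most $n-3r+l_{\nu-1}$ system zeros. 3.4. If $l_{\nu-1}<r$, $\operatorname{rank}(CAB)<l_{\nu-1}$ with rank deficiency $\bar d=l_{\nu-1}-\operatorname{rank}(CAB)$, and the system is nondegenerate, it has at most $n-3r+l_{\nu-1}-\bar d$ system zeros. Moreover, if $l_{\nu-1}<r$ (still with $CB=0$), the system is degenerate, so that the bounds in 3.3 and 3.4 concern no nondegenerate system. -/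

import Mathlib

/-!
Linear time-invariant systems `x' = A x + B u`, `y = C x` with `n` states, `r` inputs and
`l` outputs, given by real matrices `A`, `B`, `C`.
-/

namespace LinearSystem

open Polynomial

/-- The block matrix `[B, A B, ..., A ^ (k - 1) B]`, with columns indexed by
(block number, column of `B`). -/
def blockKrylov {n r : ℕ} (A : Matrix (Fin n) (Fin n) ℝ) (B : Matrix (Fin n) (Fin r) ℝ)
    (k : ℕ) : Matrix (Fin n) (Fin k × Fin r) ℝ :=
  Matrix.of fun i p => (A ^ (p.1 : ℕ) * B) i p.2

/-- The pair `(A, B)` is controllable: `rank [B, A B, ..., A ^ (n - 1) B] = n`. -/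
def IsControllable {n r : ℕ} (A : Matrix (Fin n) (Fin n) ℝ)
    (B : Matrix (Fin n) (Fin r) ℝ) : Prop :=
  (blockKrylov A B n).rank = n

/-- The controllability index `ν`: the smallest positive integer with
`rank [B, A B, ..., A ^ (n - 1) B] = rank [B, A B, ..., A ^ (ν - 1) B]`. -/
noncomputable def controllabilityIndex {n r : ℕ} (A : Matrix (Fin n) (Fin n) ℝ)
    (B : Matrix (Fin n) (Fin r) ℝ) : ℕ :=
  sInf {k : ℕ | 1 ≤ k ∧ (blockKrylov A B n).rank = (blockKrylov A B k).rank}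

/-- The integers `l_i`, for `i ≤ ν`:
`l_i = rank [B, ..., A ^ (ν - i) B] - rank [B, ..., A ^ (ν - i - 1) B]`.
So `l_ν = rank B` and `l_{ν-1} = rank [B, A B] - rank B`; for `ν = 1` the latter is `l_0 = 0`. -/
noncomputable def blockIndex {n r : ℕ} (A : Matrix (Fin n) (Fin n) ℝ)
    (B : Matrix (Fin n) (Fin r) ℝ) (i : ℕ) : ℕ :=
  (blockKrylov A B (controllabilityIndex A B + 1 - i)).rank
    - (blockKrylov A B (controllabilityIndex A B - i)).rank

/-- The system matrix `P(s) = [[s I - A, -B], [C, 0]]`, a polynomial matrix in `s`. -/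
noncomputable def systemMatrix {n r l : ℕ} (A : Matrix (Fin n) (Fin n) ℝ)
    (B : Matrix (Fin n) (Fin r) ℝ) (C : Matrix (Fin l) (Fin n) ℝ) :
    Matrix (Fin n ⊕ Fin l) (Fin n ⊕ Fin r) ℝ[X] :=
  Matrix.fromBlocks (Matrix.charmatrix A) (-(B.map Polynomial.C)) (C.map Polynomial.C) 0

/-- The minor of `P(s)` of order `n + k` formed by the first `n` rows and columns together with
`k` output rows `n + i_1 < ... < n + i_k` and `k` input columns `n + j_1 < ... < n + j_k`. -/
noncomputable def systemMinor {n r l : ℕ} (A : Matrix (Fin n) (Fin n) ℝ)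
    (B : Matrix (Fin n) (Fin r) ℝ) (C : Matrix (Fin l) (Fin n) ℝ)
    {k : ℕ} (i : Fin k ↪o Fin l) (j : Fin k ↪o Fin r) : ℝ[X] :=
  ((systemMatrix A B C).submatrix (Sum.map id i) (Sum.map id j)).det

/-- The largest `k` for which some minor `systemMinor` of order `n + k` is not identically zero
(for `k = 0` the only one is `det (s I - A)`, which never vanishes identically). -/
noncomputable def maxMinorOrder {n r l : ℕ} (A : Matrix (Fin n) (Fin n) ℝ)
    (B : Matrix (Fin n) (Fin r) ℝ) (C : Matrix (Fin l) (Fin n) ℝ) : ℕ :=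
  sSup {k : ℕ | ∃ (i : Fin k ↪o Fin l) (j : Fin k ↪o Fin r), systemMinor A B C i j ≠ 0}

/-- The zero polynomial of the system: the greatest common divisor (determined up to a nonzero
constant) of the minors `systemMinor` of the maximal order, that is, a generator of the ideal
of `ℝ[X]` spanned by them. -/
noncomputable def zeroPolynomial {n r l : ℕ} (A : Matrix (Fin n) (Fin n) ℝ)
    (B : Matrix (Fin n) (Fin r) ℝ) (C : Matrix (Fin l) (Fin n) ℝ) : ℝ[X] :=
  Submodule.IsPrincipal.generator
    (Ideal.span {p : ℝ[X] | ∃ (i : Fin (maxMinorOrder A B C) ↪o Fin l)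
      (j : Fin (maxMinorOrder A B C) ↪o Fin r), p = systemMinor A B C i j})

/-- The system zeros: the complex roots of the zero polynomial, with multiplicity. -/
noncomputable def systemZeros {n r l : ℕ} (A : Matrix (Fin n) (Fin n) ℝ)
    (B : Matrix (Fin n) (Fin r) ℝ) (C : Matrix (Fin l) (Fin n) ℝ) : Multiset ℂ :=
  ((zeroPolynomial A B C).map (algebraMap ℝ ℂ)).roots

/-- A system with as many inputs as outputs is degenerate if `det P(s)` vanishes identically
in `s`. -/
def IsDegenerate {n r : ℕ} (A : Matrix (Fin n) (Fin n) ℝ)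
    (B : Matrix (Fin n) (Fin r) ℝ) (C : Matrix (Fin r) (Fin n) ℝ) : Prop :=
  (systemMatrix A B C).det = 0

end LinearSystem

/-!
The zeros of a nondegenerate square system are the roots of `det P(s)`, so everything is a matter
of the degree of that polynomial. Suppose that row `i` of `C` satisfies `cᵢ Aʲ B = 0` for all
`j < kᵢ`. Since `s I - A` divides `sᵐ I - Aᵐ`, polynomial row operations on `P(s)` turn `sᵐ` times
the row `[cᵢ, 0]`, with `m = kᵢ + 1`, into the constant row `[cᵢ Aᵐ, cᵢ Aᵐ⁻¹ B]`. Hence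
`s ^ ∑ (kᵢ + 1) * det P(s)` has degree at most `n`, and its coefficient of `sⁿ` is the determinant
of the matrix with rows `cᵢ A^kᵢ B` (`natDegree_det_systemMatrix_add_le` and
`natDegree_det_systemMatrix_add_eq`). Constant invertible row operations on `C` change `det P(s)`
only by a nonzero constant factor. If `C A^a B` is the first nonzero Markov parameter and has rank
deficiency `d`, they make `d` of its rows zero, so that `kᵢ` can be increased from `a` to `a + 1`
for `d` indices `i` (`natDegree_det_systemMatrix_add_rank_deficiency_le`).

If `C B = 0` and `rank [B, A B] < rank B + r`, then `[B, A B]` has a nontrivial kernel: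
`B w + A B v = 0` with `(w, v) ≠ 0`. The vector `(B v, s v + w)` is nonzero and `P(s)`
annihilates it, so the system is degenerate (`isDegenerate_of_blockIndex_lt`).
-/

namespace LinearSystem

open Polynomial Matrix

variable {n r : ℕ}

/-! ### The zero polynomial of a nondegenerate system -/

lemma systemMinor_self (A : Matrix (Fin n) (Fin n) ℝ) (B : Matrix (Fin n) (Fin r) ℝ)
    (C : Matrix (Fin r) (Fin n) ℝ) (i j : Fin r ↪o Fin r) :
    systemMinor A B C i j = (systemMatrix A B C).det := by
  have h (f : Fin r ↪o Fin r) : (f : Fin r → Fin r) = id :=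
    (f.strictMono.range_inj strictMono_id).mp <| by
      rw [(Finite.surjective_of_injective f.injective).range_eq, Set.range_id]
  rw [systemMinor, h i, h j, Sum.map_id_id, submatrix_id_id]

lemma maxMinorOrder_eq {A : Matrix (Fin n) (Fin n) ℝ} {B : Matrix (Fin n) (Fin r) ℝ}
    {C : Matrix (Fin r) (Fin n) ℝ} (h : ¬ IsDegenerate A B C) : maxMinorOrder A B C = r := by
  refine IsGreatest.csSup_eq ⟨⟨RelEmbedding.refl _, RelEmbedding.refl _, ?_⟩, ?_⟩
  · rwa [systemMinor_self]
  · rintro k ⟨i, -, -⟩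
    simpa using Fintype.card_le_of_embedding i.toEmbedding

lemma card_systemZeros {A : Matrix (Fin n) (Fin n) ℝ} {B : Matrix (Fin n) (Fin r) ℝ}
    {C : Matrix (Fin r) (Fin n) ℝ} (h : ¬ IsDegenerate A B C) :
    (systemZeros A B C).card = (systemMatrix A B C).det.natDegree := by
  have hspan : {p : ℝ[X] | ∃ (i : Fin (maxMinorOrder A B C) ↪o Fin r)
      (j : Fin (maxMinorOrder A B C) ↪o Fin r), p = systemMinor A B C i j} =
      {(systemMatrix A B C).det} := by
    rw [maxMinorOrder_eq h]
    ext p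
    simp only [systemMinor_self, Set.mem_ofPred_eq, Set.mem_singleton_iff]
    exact ⟨fun ⟨_, _, hp⟩ => hp, fun hp => ⟨RelEmbedding.refl _, RelEmbedding.refl _, hp⟩⟩
  have hassoc : Associated (zeroPolynomial A B C) (systemMatrix A B C).det := by
    rw [← Ideal.span_singleton_eq_span_singleton, zeroPolynomial,
      Ideal.span_singleton_generator, hspan]
  rw [systemZeros, ← (IsAlgClosed.splits _).natDegree_eq_card_roots, natDegree_map,
    natDegree_eq_of_degree_eq (degree_eq_degree_of_associated hassoc)]

/-! ### The degree of the determinant of the system matrix -/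

/-- The matrix whose `i`-th row is `cᵢ * A ^ k i`, where `cᵢ` is the `i`-th row of `C`. -/
def rowPowMul (A : Matrix (Fin n) (Fin n) ℝ) (C : Matrix (Fin r) (Fin n) ℝ) (k : Fin r → ℕ) :
    Matrix (Fin r) (Fin n) ℝ :=
  of fun i j => (C * A ^ k i) i j

/-- The matrix polynomial with `i`-th row `cᵢ * ∑ j < m i, s ^ j * A ^ (m i - 1 - j)`, which is the
quotient of `cᵢ * (s ^ m i - A ^ m i)` by `s - A`. -/
noncomputable def rowGeomSum (A : Matrix (Fin n) (Fin n) ℝ) (C : Matrix (Fin r) (Fin n) ℝ)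
    (m : Fin r → ℕ) : Matrix (Fin r) (Fin n) ℝ[X] :=
  of fun i => (C.map Polynomial.C *
    ∑ j ∈ Finset.range (m i), scalar (Fin n) (X : ℝ[X]) ^ j *
      (A.map Polynomial.C) ^ (m i - 1 - j)) i

lemma map_C_pow (A : Matrix (Fin n) (Fin n) ℝ) (k : ℕ) :
    (A ^ k).map Polynomial.C = A.map Polynomial.C ^ k :=
  map_pow (Polynomial.C.mapMatrix) A k

lemma rowGeomSum_mul_charmatrix (A : Matrix (Fin n) (Fin n) ℝ) (C : Matrix (Fin r) (Fin n) ℝ)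
    (m : Fin r → ℕ) :
    rowGeomSum A C m * charmatrix A = diagonal (fun i => (X : ℝ[X]) ^ m i) * C.map Polynomial.C
      - (rowPowMul A C m).map Polynomial.C := by
  ext1 i j
  have hcomm : Commute (scalar (Fin n) (X : ℝ[X])) (A.map Polynomial.C) :=
    scalar_commute _ (fun _ => Commute.all _ _) _
  have hrow : (rowGeomSum A C m * charmatrix A) i j = (C.map Polynomial.C *
      (scalar (Fin n) (X : ℝ[X]) ^ m i - A.map Polynomial.C ^ m i)) i j := by
    rw [← hcomm.geom_sum₂_mul, ← Matrix.mul_assoc]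
    rfl
  rw [hrow, Matrix.mul_sub, ← map_C_pow, ← map_pow, ← Matrix.map_mul, Matrix.sub_apply,
    Matrix.sub_apply, scalar_apply, mul_diagonal, diagonal_mul, mul_comm]
  rfl

lemma rowGeomSum_mul_map (A : Matrix (Fin n) (Fin n) ℝ) (B : Matrix (Fin n) (Fin r) ℝ)
    (C : Matrix (Fin r) (Fin n) ℝ) (k : Fin r → ℕ)
    (hk : ∀ i, ∀ j < k i, (C * A ^ j * B) i = 0) :
    rowGeomSum A C (fun i => k i + 1) * B.map Polynomial.C =
      (rowPowMul A C k * B).map Polynomial.C := by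
  ext1 i l
  have hrow : (rowGeomSum A C (fun i => k i + 1) * B.map Polynomial.C) i l =
      (C.map Polynomial.C * (∑ j ∈ Finset.range (k i + 1), scalar (Fin n) (X : ℝ[X]) ^ j *
      (A.map Polynomial.C) ^ (k i + 1 - 1 - j)) * B.map Polynomial.C) i l := rfl
  have hterm (j : ℕ) : C.map Polynomial.C * (scalar (Fin n) (X : ℝ[X]) ^ j *
      (A.map Polynomial.C) ^ (k i + 1 - 1 - j)) * B.map Polynomial.C =
      (X : ℝ[X]) ^ j • (C * A ^ (k i - j) * B).map Polynomial.C := by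
    rw [← map_C_pow, ← map_pow, scalar_apply, ← smul_eq_diagonal_mul, Matrix.mul_smul,
      Matrix.smul_mul, Matrix.map_mul, Matrix.map_mul, Nat.add_sub_cancel]
  rw [hrow, Matrix.mul_sum, Matrix.sum_mul, Matrix.sum_apply, Finset.sum_range_succ',
    Finset.sum_eq_zero, zero_add, hterm, pow_zero, one_smul, Nat.sub_zero]
  · rfl
  · intro j hj
    rw [hterm, Matrix.smul_apply, Matrix.map_apply,
      congrFun (hk i (k i - (j + 1)) (by have := Finset.mem_range.mp hj; omega)) l]
    simp

/-- The extra factor `X ^ r` gives all `n + r` rows the same degree bound `1`, so that the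
determinant is that of a matrix pencil. -/
lemma X_pow_mul_det_systemMatrix (A : Matrix (Fin n) (Fin n) ℝ) (B : Matrix (Fin n) (Fin r) ℝ)
    (C : Matrix (Fin r) (Fin n) ℝ) (k : Fin r → ℕ)
    (hk : ∀ i, ∀ j < k i, (C * A ^ j * B) i = 0) :
    X ^ (r + ∑ i, (k i + 1)) * (systemMatrix A B C).det =
      det ((X : ℝ[X]) • (fromBlocks 1 0 (rowPowMul A C (fun i => k i + 1))
        (rowPowMul A C k * B)).map Polynomial.C +
        (fromBlocks (-A) (-B) 0 0).map Polynomial.C) := by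
  set m : Fin r → ℕ := fun i => k i + 1
  have hmul : fromBlocks (1 : Matrix (Fin n) (Fin n) ℝ[X]) 0 (-((X : ℝ[X]) • rowGeomSum A C m))
      ((X : ℝ[X]) • diagonal (fun i => (X : ℝ[X]) ^ m i)) * systemMatrix A B C =
      (X : ℝ[X]) • (fromBlocks 1 0 (rowPowMul A C m) (rowPowMul A C k * B)).map Polynomial.C +
        (fromBlocks (-A) (-B) 0 0).map Polynomial.C := by
    rw [systemMatrix, fromBlocks_multiply, fromBlocks_map, fromBlocks_map, fromBlocks_smul,
      fromBlocks_add]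
    congr 1
    · ext i j
      by_cases h : i = j <;> simp [charmatrix, h, sub_eq_add_neg]
    · ext i j
      simp
    · rw [Matrix.neg_mul, Matrix.smul_mul, rowGeomSum_mul_charmatrix, Matrix.smul_mul, smul_sub]
      simp
    · rw [Matrix.neg_mul, Matrix.mul_neg, neg_neg, Matrix.smul_mul, rowGeomSum_mul_map A B C k hk]
      simp
  rw [← hmul, det_mul, det_fromBlocks_zero₁₂, det_one, one_mul, det_smul, det_diagonal,
    Finset.prod_pow_eq_pow_sum, Fintype.card_fin, pow_add]

theorem natDegree_det_systemMatrix_add_le {A : Matrix (Fin n) (Fin n) ℝ}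
    {B : Matrix (Fin n) (Fin r) ℝ} {C : Matrix (Fin r) (Fin n) ℝ} {k : Fin r → ℕ}
    (hk : ∀ i, ∀ j < k i, (C * A ^ j * B) i = 0) (h : ¬ IsDegenerate A B C) :
    (systemMatrix A B C).det.natDegree + ∑ i, (k i + 1) ≤ n := by
  have hdeg := natDegree_det_X_add_C_le
    (fromBlocks 1 0 (rowPowMul A C (fun i => k i + 1)) (rowPowMul A C k * B))
    (fromBlocks (-A) (-B) 0 0)
  rw [← X_pow_mul_det_systemMatrix A B C k hk, natDegree_X_pow_mul _ h] at hdeg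
  simp only [Fintype.card_sum, Fintype.card_fin] at hdeg
  omega

theorem natDegree_det_systemMatrix_add_eq {A : Matrix (Fin n) (Fin n) ℝ}
    {B : Matrix (Fin n) (Fin r) ℝ} {C : Matrix (Fin r) (Fin n) ℝ} {k : Fin r → ℕ}
    (hk : ∀ i, ∀ j < k i, (C * A ^ j * B) i = 0) (hdet : (rowPowMul A C k * B).det ≠ 0) :
    ¬ IsDegenerate A B C ∧ (systemMatrix A B C).det.natDegree + ∑ i, (k i + 1) = n := by
  have hcoeff := coeff_det_X_add_C_card
    (fromBlocks 1 0 (rowPowMul A C (fun i => k i + 1)) (rowPowMul A C k * B))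
    (fromBlocks (-A) (-B) 0 0)
  rw [← X_pow_mul_det_systemMatrix A B C k hk, det_fromBlocks_zero₁₂, det_one, one_mul] at hcoeff
  have hnd : ¬ IsDegenerate A B C := by
    intro h
    rw [IsDegenerate] at h
    rw [h, mul_zero, coeff_zero] at hcoeff
    exact hdet hcoeff.symm
  refine ⟨hnd, (natDegree_det_systemMatrix_add_le hk hnd).antisymm ?_⟩
  have hle := le_natDegree_of_ne_zero (hcoeff.trans_ne hdet)
  rw [natDegree_X_pow_mul _ hnd] at hle
  simp only [Fintype.card_sum, Fintype.card_fin] at hle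
  omega

/-! ### Rank deficiency of the first Markov parameter -/

lemma det_ne_zero_of_rank_eq {M : Matrix (Fin r) (Fin r) ℝ} (h : M.rank = r) : M.det ≠ 0 := by
  refine (M.isUnit_iff_isUnit_det.mp (linearIndependent_cols_iff_isUnit.mp ?_)).ne_zero
  rw [linearIndependent_iff_card_eq_finrank_span, Set.finrank, ← rank_eq_finrank_span_cols, h,
    Fintype.card_fin]

/-- The rows of `U` are a basis of `ℝ ^ r` that extends a basis of the left kernel of `M`. -/
lemma exists_isUnit_mul_rows_eq_zero {M : Matrix (Fin r) (Fin r) ℝ} {d : ℕ}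
    (h : M.rank + d = r) :
    ∃ (U : Matrix (Fin r) (Fin r) ℝ) (T : Finset (Fin r)),
      IsUnit U ∧ T.card = d ∧ ∀ i ∈ T, (U * M) i = 0 := by
  have hker : Module.finrank ℝ (LinearMap.ker Mᵀ.mulVecLin) = d := by
    have := Mᵀ.mulVecLin.finrank_range_add_finrank_ker
    rw [← Matrix.rank, rank_transpose, Module.finrank_fin_fun] at this
    omega
  let b := Module.finBasisOfFinrankEq ℝ (LinearMap.ker Mᵀ.mulVecLin) hker
  have hb : LinearIndependent ℝ (fun i => (b i : Fin r → ℝ)) :=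
    b.linearIndependent.map' (Submodule.subtype _) (Submodule.ker_subtype _)
  let c := Module.Basis.sumExtend hb
  let e := c.indexEquiv (Pi.basisFun ℝ (Fin r))
  refine ⟨of fun i => c (e.symm i),
    Finset.univ.map (Function.Embedding.inl.trans e.toEmbedding), ?_, by simp, ?_⟩
  · exact linearIndependent_rows_iff_isUnit.mp (c.linearIndependent.comp _ e.symm.injective)
  · intro i hi
    obtain ⟨x, -, rfl⟩ := Finset.mem_map.mp hi
    have hx : c (Sum.inl x) = b x := by
      simp [c, Module.Basis.sumExtend]
      rfl
    have := (b x).2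
    rw [LinearMap.mem_ker, mulVecLin_apply, mulVec_transpose, ← hx] at this
    ext j
    simpa [Matrix.mul_apply, vecMul, dotProduct] using congrFun this j

lemma det_systemMatrix_mul (A : Matrix (Fin n) (Fin n) ℝ) (B : Matrix (Fin n) (Fin r) ℝ)
    (C : Matrix (Fin r) (Fin n) ℝ) (U : Matrix (Fin r) (Fin r) ℝ) :
    (systemMatrix A B (U * C)).det = Polynomial.C U.det * (systemMatrix A B C).det := by
  have hmul : systemMatrix A B (U * C) =
      fromBlocks 1 0 0 (U.map Polynomial.C) * systemMatrix A B C := by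
    simp [systemMatrix, fromBlocks_multiply, Matrix.map_mul]
  rw [hmul, det_mul, det_fromBlocks_zero₁₂, det_one, one_mul]
  congr 1
  exact (Polynomial.C.map_det U).symm

theorem natDegree_det_systemMatrix_add_rank_deficiency_le {A : Matrix (Fin n) (Fin n) ℝ}
    {B : Matrix (Fin n) (Fin r) ℝ} {C : Matrix (Fin r) (Fin n) ℝ} {a d : ℕ}
    (hvanish : ∀ j < a, C * A ^ j * B = 0) (hrank : (C * A ^ a * B).rank + d = r)
    (h : ¬ IsDegenerate A B C) :
    (systemMatrix A B C).det.natDegree + (a + 1) * r + d ≤ n := by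
  obtain ⟨U, T, hU, rfl, hT⟩ := exists_isUnit_mul_rows_eq_zero hrank
  have hdet : U.det ≠ 0 := (U.isUnit_iff_isUnit_det.mp hU).ne_zero
  have hnd : ¬ IsDegenerate A B (U * C) := by
    rw [IsDegenerate, det_systemMatrix_mul]
    exact mul_ne_zero (C_ne_zero.mpr hdet) h
  have hle := natDegree_det_systemMatrix_add_le (A := A) (B := B) (C := U * C)
    (k := fun i => a + if i ∈ T then 1 else 0) ?_ hnd
  · rw [det_systemMatrix_mul, natDegree_C_mul hdet] at hle
    simp only [Finset.sum_add_distrib, Finset.sum_const, Finset.card_univ, Fintype.card_fin,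
      smul_eq_mul, Finset.sum_ite_mem, Finset.univ_inter, mul_one] at hle
    linarith
  · intro i j hj
    simp only [Matrix.mul_assoc] at hvanish hT ⊢
    rcases Nat.lt_or_ge j a with hja | hja
    · rw [hvanish j hja, Matrix.mul_zero]
      rfl
    · have hi : i ∈ T := by
        by_contra hi
        simp [hi] at hj
        omega
      have hj' : j = a := by
        simp [hi] at hj
        omega
      rw [hj', hT i hi]

/-! ### Degeneracy -/

lemma one_le_controllabilityIndex (A : Matrix (Fin n) (Fin n) ℝ) (B : Matrix (Fin n) (Fin r) ℝ) :
    1 ≤ controllabilityIndex A B := by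
  -- The infimum is over a nonempty set: it contains `n` for `1 ≤ n`, and `1` for `n = 0`.
  refine (Nat.sInf_mem (s := {k : ℕ | 1 ≤ k ∧
    (blockKrylov A B n).rank = (blockKrylov A B k).rank}) ?_).1
  rcases n.eq_zero_or_pos with rfl | hn
  · refine ⟨1, le_rfl, ?_⟩
    have h (k : ℕ) : (blockKrylov A B k).rank = 0 := by
      simpa using (blockKrylov A B k).rank_le_card_height
    rw [h, h]
  · exact ⟨n, hn, rfl⟩

lemma blockIndex_controllabilityIndex_sub_one (A : Matrix (Fin n) (Fin n) ℝ)
    (B : Matrix (Fin n) (Fin r) ℝ) :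
    blockIndex A B (controllabilityIndex A B - 1) =
      (blockKrylov A B 2).rank - (blockKrylov A B 1).rank := by
  have h := one_le_controllabilityIndex A B
  rw [blockIndex, show controllabilityIndex A B + 1 - (controllabilityIndex A B - 1) = 2 by omega,
    show controllabilityIndex A B - (controllabilityIndex A B - 1) = 1 by omega]

lemma blockKrylov_two_mulVec (A : Matrix (Fin n) (Fin n) ℝ) (B : Matrix (Fin n) (Fin r) ℝ)
    (x : Fin 2 × Fin r → ℝ) :
    blockKrylov A B 2 *ᵥ x =
      B *ᵥ (fun j => x (0, j)) + (A * B) *ᵥ (fun j => x (1, j)) := by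
  ext i
  simp [blockKrylov, mulVec, dotProduct, Fintype.sum_prod_type]

/-- A relation `B w + A B v = 0` yields the polynomial null vector `(B v, s v + w)` of `P(s)`. -/
lemma isDegenerate_of_mulVec_add_eq_zero {A : Matrix (Fin n) (Fin n) ℝ}
    {B : Matrix (Fin n) (Fin r) ℝ} {C : Matrix (Fin r) (Fin n) ℝ} (hCB : C * B = 0)
    {v w : Fin r → ℝ} (hvw : B *ᵥ w + (A * B) *ᵥ v = 0) (hne : v ≠ 0 ∨ w ≠ 0) :
    IsDegenerate A B C := by
  have hmap {p q : ℕ} (M : Matrix (Fin p) (Fin q) ℝ) (u : Fin q → ℝ) :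
      M.map Polynomial.C *ᵥ (fun i => Polynomial.C (u i)) =
        fun i => Polynomial.C ((M *ᵥ u) i) := by
    ext1 i
    simp [mulVec, dotProduct]
  refine exists_mulVec_eq_zero_iff.mp ⟨Sum.elim (fun i => Polynomial.C ((B *ᵥ v) i))
    ((X : ℝ[X]) • (fun j => Polynomial.C (v j)) + fun j => Polynomial.C (w j)), ?_, ?_⟩
  · intro h0
    have hj (j : Fin r) : X * Polynomial.C (v j) + Polynomial.C (w j) = 0 := by
      simpa using congrFun h0 (Sum.inr j)
    rcases hne with hne | hne <;> refine hne (funext fun j => ?_)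
    · simpa using congrArg (fun p => coeff p 1) (hj j)
    · simpa using congrArg (fun p => coeff p 0) (hj j)
  · rw [systemMatrix, fromBlocks_mulVec]
    simp only [Sum.elim_comp_inl, Sum.elim_comp_inr, charmatrix, sub_mulVec, neg_mulVec,
      mulVec_add, mulVec_smul, zero_mulVec, add_zero, hmap, RingHom.mapMatrix_apply, scalar_apply,
      mulVec_mulVec, hCB]
    ext1 (i | i)
    · have hi : (B *ᵥ w) i = -((A * B) *ᵥ v) i := eq_neg_of_add_eq_zero_left (congrFun hvw i)
      simp [hi]
    · simp

theorem isDegenerate_of_blockIndex_lt {A : Matrix (Fin n) (Fin n) ℝ}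
    {B : Matrix (Fin n) (Fin r) ℝ} {C : Matrix (Fin r) (Fin n) ℝ} (hCB : C * B = 0)
    (hlt : blockIndex A B (controllabilityIndex A B - 1) < r) : IsDegenerate A B C := by
  rw [blockIndex_controllabilityIndex_sub_one] at hlt
  have hone : (blockKrylov A B 1).rank ≤ r := by
    simpa using (blockKrylov A B 1).rank_le_card_width
  have hker : LinearMap.ker (blockKrylov A B 2).mulVecLin ≠ ⊥ := by
    intro hbot
    have := (blockKrylov A B 2).mulVecLin.finrank_range_add_finrank_ker
    rw [hbot, finrank_bot, ← Matrix.rank, Module.finrank_fintype_fun_eq_card, Fintype.card_prod,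
      Fintype.card_fin, Fintype.card_fin] at this
    omega
  obtain ⟨x, hx, hx0⟩ := Submodule.exists_mem_ne_zero_of_ne_bot hker
  rw [LinearMap.mem_ker, mulVecLin_apply, blockKrylov_two_mulVec] at hx
  refine isDegenerate_of_mulVec_add_eq_zero hCB hx ?_
  by_contra! h
  refine hx0 (funext fun ⟨b, j⟩ => ?_)
  fin_cases b
  · exact congrFun h.2 j
  · exact congrFun h.1 j

end LinearSystem

/-! ### The number of zeros -/

open LinearSystem in
theorem theorem7p5 (n r : ℕ) (A : Matrix (Fin n) (Fin n) ℝ) (B : Matrix (Fin n) (Fin r) ℝ)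
    (C : Matrix (Fin r) (Fin n) ℝ) (hAB : IsControllable A B) :
    -- 1. `rank (CB) = r`
    ((C * B).rank = r → (systemZeros A B C).card + r = n) ∧
    -- 2. `CB` has rank deficiency `d`
    (¬ IsDegenerate A B C → ∀ d : ℕ, (C * B).rank + d = r →
      (systemZeros A B C).card + r + d ≤ n) ∧
    -- 3. `CB = 0`
    (C * B = 0 →
      -- 3.1
      (blockIndex A B (controllabilityIndex A B - 1) = r → (C * A * B).rank = r →
        (systemZeros A B C).card + 2 * r = n) ∧
      -- 3.2
      (¬ IsDegenerate A B C → blockIndex A B (controllabilityIndex A B - 1) = r →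
        (C * A * B).rank < r → ∀ d : ℕ, (C * A * B).rank + d = r →
        (systemZeros A B C).card + 2 * r + d ≤ n) ∧
      -- 3.3
      (¬ IsDegenerate A B C → blockIndex A B (controllabilityIndex A B - 1) < r →
        (C * A * B).rank = blockIndex A B (controllabilityIndex A B - 1) →
        (systemZeros A B C).card + 3 * r
          ≤ n + blockIndex A B (controllabilityIndex A B - 1)) ∧
      -- 3.4
      (¬ IsDegenerate A B C → blockIndex A B (controllabilityIndex A B - 1) < r →
        (C * A * B).rank < blockIndex A B (controllabilityIndex A B - 1) →
        ∀ d : ℕ, (C * A * B).rank + d = blockIndex A B (controllabilityIndex A B - 1) →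
        (systemZeros A B C).card + 3 * r + d
          ≤ n + blockIndex A B (controllabilityIndex A B - 1)) ∧
      -- the common hypothesis of 3.3 and 3.4 forces degeneracy
      (blockIndex A B (controllabilityIndex A B - 1) < r → IsDegenerate A B C)) := by

  have hrow (a : ℕ) : rowPowMul A C (fun _ => a) = C * A ^ a := rfl
  refine ⟨fun h => ?_, fun hnd d hd => ?_, fun hCB => ?_⟩
  · obtain ⟨hnd, hdeg⟩ := natDegree_det_systemMatrix_add_eq (A := A) (B := B) (C := C)
      (k := fun _ => 0) (by simp) (by simpa [hrow] using det_ne_zero_of_rank_eq h)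
    simpa [card_systemZeros hnd] using hdeg
  · have := natDegree_det_systemMatrix_add_rank_deficiency_le (a := 0) (by simp)
      (by simpa using hd) hnd
    simpa [card_systemZeros hnd] using this
  · have hvanish : ∀ j < 1, C * A ^ j * B = 0 := by simpa using hCB
    refine ⟨fun _ h => ?_, fun hnd _ _ d hd => ?_, fun hnd hlt => ?_, fun hnd hlt => ?_,
      isDegenerate_of_blockIndex_lt hCB⟩
    · obtain ⟨hnd, hdeg⟩ := natDegree_det_systemMatrix_add_eq (A := A) (B := B) (C := C)
        (k := fun _ => 1) (fun i j hj => congrFun (hvanish j hj) i)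
        (by simpa [hrow] using det_ne_zero_of_rank_eq h)
      simpa [card_systemZeros hnd, mul_comm] using hdeg
    · rw [card_systemZeros hnd]
      exact natDegree_det_systemMatrix_add_rank_deficiency_le hvanish (by simpa using hd) hnd
    · exact absurd (isDegenerate_of_blockIndex_lt hCB hlt) hnd
    · exact absurd (isDegenerate_of_blockIndex_lt hCB hlt) hnd
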